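/- All groups are finite. Let $\mathfrak{F}$ be a formation (a class of groups closed under homomorphic images such that $G/M,\,G/N\in\mathfrak{F}$ implies $G/(M\cap N)\in\mathfrak{F}$) which is hereditary (closed under subgroups), saturated ($G/\Phi(G)\in\mathfrak{F}$ implies $G\in\mathfrak{F}$) and contains all nilpotent groups. A generalized rank function $\mathcal{R}$ assigns to each simple group $S$ a pair $\mathcal{R}(S)=(A_{\mathcal{R}}(S),B_{\mathcal{R}}(S))$ of possibly empty disjoint sets of natural numbers $1,2,\dots$, and $\mathcal{R}(N)=\mathcal{R}(S)$ whenever $N$ is a direct product of groups isomorphic to $S$. It is very good if, for every simple group $S$ and all natural numbers $b\le a$, $a\in A_{\mathcal{R}}(S)$ implies $b\in A_{\mathcal{R}}(S)$, and $a\in B_{\mathcal{R}}(S)$ implies $b\in B_{\mathcal{R}}(S)$. The rank $r(\overline{H},G)$ of a chief factor $\overline{H}$ of $G$ is the number $n$ such that $\overline{H}$ is a direct product of $n$ isomorphic simple groups. Write $gr(\overline{H},G)\in\mathcal{R}(\overline{H})$ if either $r(\overline{H},G)\in A_{\mathcal{R}}(\overline{H})$, or $r(\overline{H},G)\in B_{\mathcal{R}}(\overline{H})$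 and, whenever an element $x\in G$ fixes a composition factor $\overline{A}/\overline{B}$ of $\overline{H}$ (that is, $\overline{A}^x=\overline{A}$ and $\overline{B}^x=\overline{B}$), $x$ induces an inner automorphism on $\overline{A}/\overline{B}$. For a class of groups $\mathfrak{X}$, a chief factor $\overline{H}$ of $G$ is $\mathfrak{X}$-central if $\overline{H}\rtimes G/C_G(\overline{H})\in\mathfrak{X}$, and $\mathfrak{X}$-eccentric otherwise. The $\mathfrak{X}$-hypercenter $\mathrm{Z}_{\mathfrak{X}}(G)$ is the largest normal subgroup of $G$ such that every chief factor of $G$ below it is $\mathfrak{X}$-central. A subgroup $U$ of $G$ is $\mathfrak{X}$-maximal if $U\in\mathfrak{X}$ and $U\le V\le G$, $V\in\mathfrak{X}$ imply $U=V$; $\mathrm{Int}_{\mathfrak{X}}(G)$ is the intersection of all $\mathfrak{X}$-maximal subgroups of $G$. Let $\mathfrak{F}(\mathcal{R})$ be the class of all groups $G$ such that $\overline{H}\notin\mathfrak{F}$ and $gr(\overline{H},G)\in\mathcal{R}(\overline{H})$ for every $\mathfrak{F}$-eccentric chief factor $\overline{H}$ of $G$. If $\mathcal{R}$ is a very good generalized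 rank function, then for every group $G$ $$\mathrm{Z}_{\mathfrak{F}(\mathcal{R})}(G)\le \mathrm{Int}_{\mathfrak{F}(\mathcal{R})}(G).$$ -/

import Mathlib

universe u

/-- A class of finite groups. -/
abbrev GroupClass : Type (u + 1) := ∀ (G : Type u) [Group G] [Finite G], Prop

instance SemidirectProduct.instFiniteOfFinite {N G : Type*} [Group N] [Group G] [Finite N]
    [Finite G] (φ : G →* MulAut N) : Finite (N ⋊[φ] G) :=
  Finite.of_equiv (N × G) SemidirectProduct.equivProd.symm

namespace GroupClass

/-- A formation: closed under homomorphic images, and `G/M, G/N ∈ 𝔛` implies `G/(M ∩ N) ∈ 𝔛`. -/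
structure IsFormation (X : GroupClass.{u}) : Prop where
  of_surjective : ∀ {G H : Type u} [Group G] [Finite G] [Group H] [Finite H] (f : G →* H),
    Function.Surjective f → X G → X H
  of_quotients : ∀ {G : Type u} [Group G] [Finite G] (M N : Subgroup G) [M.Normal] [N.Normal],
    X (G ⧸ M) → X (G ⧸ N) → X (G ⧸ (M ⊓ N))

/-- `𝔛` is saturated: `G/Φ(G) ∈ 𝔛` implies `G ∈ 𝔛`. -/
def IsSaturated (X : GroupClass.{u}) : Prop :=
  ∀ (G : Type u) [Group G] [Finite G], X (G ⧸ frattini G) → X G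

/-- `𝔛` is hereditary: closed under taking subgroups. -/
def IsHereditary (X : GroupClass.{u}) : Prop :=
  ∀ (G : Type u) [Group G] [Finite G] (U : Subgroup G), X G → X U

/-- `𝔛` contains every (finite) nilpotent group. -/
def ContainsNilpotent (X : GroupClass.{u}) : Prop :=
  ∀ (G : Type u) [Group G] [Finite G], Group.IsNilpotent G → X G

end GroupClass

/-- A chief factor `top/bot` of `G`: `bot < top` are normal subgroups of `G` with no normal
subgroup of `G` strictly between them. -/
structure ChiefFactor (G : Type u) [Group G] where
  top : Subgroup G
  bot : Subgroup G
  top_normal : top.Normal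
  bot_normal : bot.Normal
  bot_lt_top : bot < top
  eq_or_eq : ∀ L : Subgroup G, L.Normal → bot ≤ L → L ≤ top → L = bot ∨ L = top

namespace ChiefFactor

variable {G : Type u} [Group G]

instance instBotNormal (C : ChiefFactor G) : C.bot.Normal := C.bot_normal

instance instTopNormal (C : ChiefFactor G) : C.top.Normal := C.top_normal

/-- The chief factor `top/bot` as a subgroup of `G/bot`. -/
def quot (C : ChiefFactor G) : Subgroup (G ⧸ C.bot) :=
  C.top.map (QuotientGroup.mk' C.bot)

instance instQuotNormal (C : ChiefFactor G) : C.quot.Normal :=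
  Subgroup.Normal.map C.top_normal _ (QuotientGroup.mk'_surjective C.bot)

/-- The conjugation action of `G` on the chief factor. Its kernel is the centralizer of the chief
factor in `G`. -/
noncomputable def action (C : ChiefFactor G) : G →* MulAut C.quot :=
  MulAut.conjNormal.comp (QuotientGroup.mk' C.bot)

/-- The semidirect product of a chief factor `top/bot` with `G/C_G(top/bot)`. -/
abbrev semidirect (C : ChiefFactor G) : Type u :=
  C.quot ⋊[QuotientGroup.kerLift C.action] (G ⧸ C.action.ker)

/-- The chief factor is `𝔛`-central in `G`. -/
def IsCentral [Finite G] (X : GroupClass.{u}) (C : ChiefFactor G) : Prop :=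
  X C.semidirect

end ChiefFactor

/-- `𝔛`-hypercenter of `G`: the largest normal subgroup `Z` of `G` such that every chief factor of
`G` below `Z` is `𝔛`-central. It is written as the join of all the normal subgroups with this
property. -/
def hypercenter (X : GroupClass.{u}) (G : Type u) [Group G] [Finite G] : Subgroup G :=
  sSup {Z | Z.Normal ∧ ∀ C : ChiefFactor G, C.top ≤ Z → C.IsCentral X}

/-- `U` is an `𝔛`-maximal subgroup of `G`. -/
def IsMaximalIn (X : GroupClass.{u}) {G : Type u} [Group G] [Finite G] (U : Subgroup G) : Prop :=
  X U ∧ ∀ V : Subgroup G, U ≤ V → X V → U = V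

/-- `Int_𝔛(G)`: the intersection of all `𝔛`-maximal subgroups of `G`. -/
def intMaximal (X : GroupClass.{u}) (G : Type u) [Group G] [Finite G] : Subgroup G :=
  sInf {U | IsMaximalIn X U}

/-- `N` is the direct product of `n ≥ 1` groups isomorphic to `S`. -/
def IsDirectPower (N S : Type u) [Group N] [Group S] (n : ℕ) : Prop :=
  1 ≤ n ∧ Nonempty (N ≃* (Fin n → S))

/-- A generalized rank function. It is a map on the direct products of isomorphic finite simple
groups; its values on all other groups are never used. The natural numbers are `1, 2, 3, …`; since
ranks are positive, membership of `0` in `A S` or `B S` never matters. -/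
structure GeneralizedRankFunction where
  A : ∀ (N : Type u) [Group N] [Finite N], Set ℕ
  B : ∀ (N : Type u) [Group N] [Finite N], Set ℕ
  disjoint : ∀ (S : Type u) [Group S] [Finite S], IsSimpleGroup S → Disjoint (A S) (B S)
  A_eq : ∀ (N S : Type u) [Group N] [Finite N] [Group S] [Finite S] (n : ℕ),
    IsSimpleGroup S → IsDirectPower N S n → A N = A S
  B_eq : ∀ (N S : Type u) [Group N] [Finite N] [Group S] [Finite S] (n : ℕ),
    IsSimpleGroup S → IsDirectPower N S n → B N = B S

namespace GeneralizedRankFunction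

/-- For every simple `S`: if `a ∈ A(S)` then `b ∈ A(S)` for all natural `b ≤ a`, and if `a ∈ B(S)`
then `b ∈ B(S)` for all natural `b ≤ a`. -/
def IsVeryGood (R : GeneralizedRankFunction.{u}) : Prop :=
  ∀ (S : Type u) [Group S] [Finite S], IsSimpleGroup S →
    (∀ a ∈ R.A S, ∀ b : ℕ, 1 ≤ b → b ≤ a → b ∈ R.A S) ∧
    (∀ a ∈ R.B S, ∀ b : ℕ, 1 ≤ b → b ≤ a → b ∈ R.B S)

end GeneralizedRankFunction

/-- `A/B` is a composition factor of `N`: `A` is subnormal in `N`, `B` is normal in `A`, and `A/B`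
is simple. -/
structure IsCompositionFactor {N : Type u} [Group N] (A B : Subgroup N) : Prop where
  subnormal : A.IsSubnormal
  le : B ≤ A
  normal : (B.subgroupOf A).Normal
  simple : IsSimpleGroup (A ⧸ B.subgroupOf A)

namespace ChiefFactor

variable {G : Type u} [Group G]

/-- `n` is the rank of the chief factor: the factor is a direct product of `n` isomorphic simple
groups. -/
def HasRank (C : ChiefFactor G) (n : ℕ) : Prop :=
  ∃ (S : Type u) (_ : Group S), IsSimpleGroup S ∧ IsDirectPower C.quot S n

/-- `x` fixes the section `A/B` of the chief factor. -/
def Fixes (C : ChiefFactor G) (x : G) (A B : Subgroup C.quot) : Prop :=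
  A.map (C.action x).toMonoidHom = A ∧ B.map (C.action x).toMonoidHom = B

/-- `x` acts on the section `A/B` of the chief factor as the inner automorphism induced by some
`a ∈ A`. -/
def InducesInner (C : ChiefFactor G) (x : G) (A B : Subgroup C.quot) : Prop :=
  ∃ a ∈ A, ∀ y ∈ A, (a * y * a⁻¹)⁻¹ * C.action x y ∈ B

/-- The generalized rank of the chief factor lies in `R(top/bot)`. -/
def GenRankMem [Finite G] (R : GeneralizedRankFunction.{u}) (C : ChiefFactor G) : Prop :=
  ∃ n : ℕ, C.HasRank n ∧
    (n ∈ R.A C.quot ∨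
      (n ∈ R.B C.quot ∧
        ∀ (x : G) (A B : Subgroup C.quot), IsCompositionFactor A B →
          C.Fixes x A B → C.InducesInner x A B))

end ChiefFactor

/-- The class `𝔛(R)`: all groups `G` such that `H ∉ 𝔛` and `gr(H, G) ∈ R(H)` for every
`𝔛`-eccentric chief factor `H` of `G`. -/
def GroupClass.withRank (X : GroupClass.{u}) (R : GeneralizedRankFunction.{u}) : GroupClass.{u} :=
  fun G _ _ => ∀ C : ChiefFactor G, ¬ C.IsCentral X → ¬ X C.quot ∧ C.GenRankMem R

/-!
Write `𝔛` for `F.withRank R`. It suffices to show that `U Z ∈ 𝔛` whenever `U ∈ 𝔛` and `Z` is a normal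
subgroup of `G` all of whose chief factors are `𝔛`-central: if `U` is `𝔛`-maximal, then `Z ≤ U`, so
the join of all these `Z` lies in `U`. This is `withRank_sup`.

Membership in `𝔛` asks that the action of `G` on each of its chief factors be admissible
(`IsAdmissible`). This property passes to nontrivial normal sections of groups with operators,
where the operators may change as well (`NormalSection.isAdmissible`). If `N ⋊ G/C_G(N)` lies in `F`,
the corresponding semidirect product of a section is a quotient of a subgroup of it. Otherwise `N`
is a power `S^n` of a nonabelian simple group `S`, because `F` contains the nilpotent groups. Its
normal subgroups are products of some of the factors, so a nontrivial normal section is `S^k` with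
`1 ≤ k ≤ n`, and `R` is very good; the condition on inner automorphisms is inherited because
composition factors of the section are composition factors of `N`.

A chief factor of `U Z` is a normal section of something admissible. If `Z` does not cover it, it
comes from a chief factor of `U`, which is admissible since `U ∈ 𝔛`
(`ChiefFactor.exists_normalSection`). If `Z` covers it, it is a section of a chief factor `C` of `G`
below `Z`. Then `C ⋊ G/C_G(C) ∈ 𝔛`, where `C` is a minimal normal subgroup with the same operators
(`ChiefFactor.normalSectionOfSemidirect`), so `C` is admissible too.
-/

/-! ### Normal subgroups and quotients of direct powers of a nonabelian simple group -/

section DirectPower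

variable {ι S : Type*} [Group S]

/-- The coordinates in which some element of `B` is nontrivial. -/
def Subgroup.piSupport (B : Subgroup (ι → S)) : Set ι := {i | ∃ b ∈ B, b i ≠ 1}

/-- If an element `b` of a normal subgroup `B` has a nontrivial coordinate at `i`, the commutators
of `b` with the `i`-th factor lie in `B`; as that factor is simple with trivial centre, `B` contains
all of it. -/
theorem Subgroup.mulSingle_mem_of_mem_piSupport [DecidableEq ι] (hS : IsSimpleGroup S)
    (hna : ∃ a b : S, a * b ≠ b * a) (B : Subgroup (ι → S)) [hB : B.Normal] {i : ι}
    (hi : i ∈ B.piSupport) (s : S) : Pi.mulSingle i s ∈ B := by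
  obtain ⟨b, hb, hbi⟩ := hi
  have hn : (B.comap (MonoidHom.mulSingle (fun _ : ι => S) i)).Normal := hB.comap _
  rcases hn.eq_bot_or_eq_top with h | h
  · exfalso
    have hc : b i ∈ Subgroup.center S := by
      rw [Subgroup.mem_center_iff]
      intro t
      have hmem : MonoidHom.mulSingle (fun _ : ι => S) i (t * b i * t⁻¹ * (b i)⁻¹) ∈ B := by
        have h1 := B.mul_mem (hB.conj_mem b hb (Pi.mulSingle i t)) (B.inv_mem hb)
        convert h1 using 1
        ext j
        rcases eq_or_ne j i with rfl | hj
        · simp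
        · simp [hj]
      have h2 : t * b i * t⁻¹ * (b i)⁻¹ ∈ (⊥ : Subgroup S) := by
        rw [← h]; exact hmem
      rw [Subgroup.mem_bot] at h2
      rw [← mul_inv_eq_one]
      simpa [mul_assoc] using h2
    rcases (inferInstance : (Subgroup.center S).Normal).eq_bot_or_eq_top with hz | hz
    · rw [hz, Subgroup.mem_bot] at hc
      exact hbi hc
    · obtain ⟨x, y, hxy⟩ := hna
      have : y ∈ Subgroup.center S := hz ▸ Subgroup.mem_top y
      exact hxy (Subgroup.mem_center_iff.1 this x)
  · have : s ∈ B.comap (MonoidHom.mulSingle (fun _ : ι => S) i) := h ▸ Subgroup.mem_top s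
    exact this

theorem Subgroup.mem_iff_forall_notMem_piSupport [Finite ι] (hS : IsSimpleGroup S)
    (hna : ∃ a b : S, a * b ≠ b * a) (B : Subgroup (ι → S)) [B.Normal] (f : ι → S) :
    f ∈ B ↔ ∀ i ∉ B.piSupport, f i = 1 := by
  classical
  refine ⟨fun hf i hi => by_contra fun h => hi ⟨f, hf, h⟩, fun hf => ?_⟩
  refine Subgroup.pi_mem_of_mulSingle_mem f fun i => ?_
  by_cases hi : i ∈ B.piSupport
  · exact B.mulSingle_mem_of_mem_piSupport hS hna hi _
  · rw [hf i hi, Pi.mulSingle_one]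
    exact B.one_mem

/-- Restriction of functions to a set of coordinates. -/
def piRestrictHom (S : Type*) [Group S] (J : Set ι) : (ι → S) →* (J → S) where
  toFun f j := f j
  map_one' := rfl
  map_mul' _ _ := rfl

theorem exists_piRestrictHom_eq (J : Set ι) (g : J → S) :
    ∃ f, piRestrictHom S J f = g ∧ ∀ i ∉ J, f i = 1 := by
  classical
  refine ⟨fun i => if h : i ∈ J then g ⟨i, h⟩ else 1, ?_, fun i hi => dif_neg hi⟩
  ext j
  simp [piRestrictHom]

/-- A normal subgroup of a direct power of a nonabelian simple group is the direct product of the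
factors in its support. -/
theorem Subgroup.nonempty_mulEquiv_pi [Finite ι] (hS : IsSimpleGroup S)
    (hna : ∃ a b : S, a * b ≠ b * a) (B : Subgroup (ι → S)) [B.Normal] :
    Nonempty (B ≃* (B.piSupport → S)) := by
  have hmem := B.mem_iff_forall_notMem_piSupport hS hna
  refine ⟨MulEquiv.ofBijective ((piRestrictHom S B.piSupport).comp B.subtype) ⟨?_, fun g => ?_⟩⟩
  · rintro ⟨f, hf⟩ ⟨g, hg⟩ h
    ext i
    by_cases hi : i ∈ B.piSupport
    · exact congrFun h ⟨i, hi⟩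
    · exact ((hmem f).1 hf i hi).trans ((hmem g).1 hg i hi).symm
  · obtain ⟨f, hf, hf1⟩ := exists_piRestrictHom_eq B.piSupport g
    exact ⟨⟨f, (hmem f).2 hf1⟩, hf⟩

/-- A quotient of a direct power of a nonabelian simple group is again a direct power, over the
coordinates on which the kernel is trivial. -/
theorem nonempty_mulEquiv_pi_of_surjective [Finite ι] (hS : IsSimpleGroup S)
    (hna : ∃ a b : S, a * b ≠ b * a) {N : Type*} [Group N] (g : (ι → S) →* N)
    (hg : Function.Surjective g) : Nonempty (N ≃* ((g.ker.piSupportᶜ : Set ι) → S)) := by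
  have hmem := g.ker.mem_iff_forall_notMem_piSupport hS hna
  have hker : (piRestrictHom S g.ker.piSupportᶜ).ker = g.ker := by
    ext f
    rw [hmem, MonoidHom.mem_ker]
    exact ⟨fun h i hi => congrFun h ⟨i, hi⟩, fun h => funext fun i => h i i.2⟩
  refine ⟨(QuotientGroup.quotientKerEquivOfSurjective g hg).symm.trans
    ((QuotientGroup.quotientMulEquivOfEq hker.symm).trans
      (QuotientGroup.quotientKerEquivOfSurjective _ fun f => ?_))⟩
  obtain ⟨f', hf', -⟩ := exists_piRestrictHom_eq _ f
  exact ⟨f', hf'⟩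

end DirectPower

theorem isDirectPower_of_mulEquiv {ι : Type*} [Finite ι] {N S : Type u} [Group N] [Group S]
    [Nontrivial N] (e : N ≃* (ι → S)) : IsDirectPower N S (Nat.card ι) := by
  refine ⟨Nat.one_le_iff_ne_zero.2 fun h => ?_,
    ⟨e.trans (MulEquiv.arrowCongr (Finite.equivFin ι) (MulEquiv.refl S))⟩⟩
  have : IsEmpty ι := (Nat.card_eq_zero.1 h).resolve_right (not_infinite_iff_finite.2 ‹_›)
  exact not_subsingleton N e.toEquiv.subsingleton

/-- A nontrivial quotient of a normal subgroup of a direct power of a nonabelian simple group `S` is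
a direct power of `S` with at most as many factors. -/
theorem IsDirectPower.of_normal_section {T N N' S : Type u} [Group T] [Group N] [Group N']
    [Group S] [Nontrivial N'] (hS : IsSimpleGroup S) (hna : ∃ a b : S, a * b ≠ b * a) {n : ℕ}
    (hN : IsDirectPower N S n) (α : T →* N) (hα : Function.Injective α) (hαn : α.range.Normal)
    (β : T →* N') (hβ : Function.Surjective β) : ∃ k ≤ n, IsDirectPower N' S k := by
  obtain ⟨-, ⟨e⟩⟩ := hN
  have hαe : Function.Injective (e.toMonoidHom.comp α) := e.injective.comp hα
  have hB : (e.toMonoidHom.comp α).range.Normal := by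
    rw [MonoidHom.range_comp]
    exact hαn.map _ e.surjective
  obtain ⟨e₁⟩ := Subgroup.nonempty_mulEquiv_pi hS hna (e.toMonoidHom.comp α).range
  have e₂ := (MonoidHom.ofInjective hαe).trans e₁
  obtain ⟨e₃⟩ := nonempty_mulEquiv_pi_of_surjective hS hna (β.comp e₂.symm.toMonoidHom)
    (hβ.comp e₂.symm.surjective)
  refine ⟨_, ?_, isDirectPower_of_mulEquiv e₃⟩
  calc _ ≤ Nat.card _ := Finite.card_subtype_le _
    _ ≤ Nat.card (Fin n) := Finite.card_subtype_le _
    _ = n := Nat.card_fin n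

namespace GroupClass

/-! ### Closure properties of formations -/

variable {F : GroupClass.{u}}

theorem IsFormation.of_mulEquiv (hF : F.IsFormation) {G H : Type u} [Group G] [Finite G] [Group H]
    [Finite H] (e : G ≃* H) (hG : F G) : F H :=
  hF.of_surjective e.toMonoidHom e.surjective hG

theorem IsFormation.of_injective (hF : F.IsFormation) (hher : F.IsHereditary) {G H : Type u}
    [Group G] [Finite G] [Group H] [Finite H] (f : H →* G) (hf : Function.Injective f) (hG : F G) :
    F H :=
  hF.of_mulEquiv (MonoidHom.ofInjective hf).symm (hher G f.range hG)

theorem IsFormation.prod (hF : F.IsFormation) {G H : Type u} [Group G] [Finite G] [Group H]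
    [Finite H] (hG : F G) (hH : F H) : F (G × H) := by
  have h := hF.of_quotients (MonoidHom.fst G H).ker (MonoidHom.snd G H).ker
    (hF.of_mulEquiv (QuotientGroup.quotientKerEquivOfSurjective _ Prod.fst_surjective).symm hG)
    (hF.of_mulEquiv (QuotientGroup.quotientKerEquivOfSurjective _ Prod.snd_surjective).symm hH)
  have hbot : (MonoidHom.fst G H).ker ⊓ (MonoidHom.snd G H).ker = ⊥ := by
    ext x
    simp [Subgroup.mem_inf, Subgroup.mem_prod, Prod.ext_iff]
  exact hF.of_mulEquiv ((QuotientGroup.quotientMulEquivOfEq hbot).trans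
    QuotientGroup.quotientBot) h

theorem IsFormation.pi (hF : F.IsFormation) (hnil : F.ContainsNilpotent) {S : Type u} [Group S]
    [Finite S] (hS : F S) (n : ℕ) : F (Fin n → S) := by
  induction n with
  | zero => exact hnil _ inferInstance
  | succ n ih =>
    refine hF.of_surjective (G := S × (Fin n → S))
      { toFun := fun p => Fin.cons p.1 p.2
        map_one' := ?_
        map_mul' := fun p q => ?_ } (fun f => ⟨(f 0, fun i => f i.succ), ?_⟩) (hF.prod hS ih)
    all_goals
      ext i
      refine Fin.cases ?_ (fun j => ?_) i <;> simp

/-- Whether a direct power of `S` lies in the formation does not depend on the number of factors. -/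
theorem IsFormation.of_isDirectPower (hF : F.IsFormation) (hnil : F.ContainsNilpotent)
    {N N' S : Type u} [Group N] [Finite N] [Group N'] [Finite N'] [Group S] {n k : ℕ}
    (hN : IsDirectPower N S n) (hN' : IsDirectPower N' S k) (h : F N) : F N' := by
  obtain ⟨hn, ⟨e⟩⟩ := hN
  obtain ⟨-, ⟨e'⟩⟩ := hN'
  have hsurj : Function.Surjective ((Pi.evalMonoidHom (fun _ => S) (⟨0, hn⟩ : Fin n)).comp
      e.toMonoidHom) := (Function.surjective_eval _).comp e.surjective
  have : Finite S := Finite.of_surjective _ hsurj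
  exact hF.of_mulEquiv e'.symm (hF.pi hnil (hF.of_surjective _ hsurj h) k)

/-- A direct power outside a formation containing the nilpotent groups has a nonabelian factor. -/
theorem exists_not_commute (hnil : F.ContainsNilpotent) {N S : Type u} [Group N] [Finite N]
    [Group S] {n : ℕ} (hN : IsDirectPower N S n) (h : ¬ F N) : ∃ a b : S, a * b ≠ b * a := by
  by_contra! hc
  obtain ⟨-, ⟨e⟩⟩ := hN
  refine h (hnil N ?_)
  have hcomm : ∀ x y : N, x * y = y * x := fun x y => e.injective (by
    rw [map_mul, map_mul]; exact funext fun i => hc _ _)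
  let : CommGroup N := { ‹Group N› with mul_comm := hcomm }
  infer_instance

end GroupClass

/-! ### Normal sections of groups with operators -/

/-- A group `N` with an action `φ` of a group `G` is admissible if `N ⋊ G/ker φ` lies in `F`, or `N`
does not lie in `F` and its generalized rank lies in `R N`. For the conjugation action on a chief
factor, this is the condition which membership in `F.withRank R` imposes on that factor. -/
def IsAdmissible (F : GroupClass.{u}) (R : GeneralizedRankFunction.{u}) {G N : Type u} [Group G]
    [Finite G] [Group N] [Finite N] (φ : G →* MulAut N) : Prop :=
  F (N ⋊[QuotientGroup.kerLift φ] (G ⧸ φ.ker)) ∨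
    (¬ F N ∧ ∃ n : ℕ, (∃ (S : Type u) (_ : Group S), IsSimpleGroup S ∧ IsDirectPower N S n) ∧
      (n ∈ R.A N ∨ (n ∈ R.B N ∧ ∀ (x : G) (A B : Subgroup N), IsCompositionFactor A B →
        (A.map (φ x).toMonoidHom = A ∧ B.map (φ x).toMonoidHom = B) →
          ∃ a ∈ A, ∀ y ∈ A, (a * y * a⁻¹)⁻¹ * φ x y ∈ B)))

theorem GroupClass.withRank_iff (F : GroupClass.{u}) (R : GeneralizedRankFunction.{u})
    (G : Type u) [Group G] [Finite G] :
    F.withRank R G ↔ ∀ C : ChiefFactor G, IsAdmissible F R C.action :=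
  forall_congr' fun _ => or_iff_not_imp_left.symm

/-- The group `N'` with an action `φ'` of `G'` is a normal section of the group `N` with an action
`φ` of `G`: a quotient of a normal subgroup of `N`, such that the action of every element of `G'` is
induced by that of some element of `G`. The section is encoded by the relation `rel`, the graph of
the map from the normal subgroup onto `N'`, and the correspondence of the operators by the
relation `op`. -/
structure NormalSection {G N G' N' : Type*} [Group G] [Group N] [Group G'] [Group N']
    (φ : G →* MulAut N) (φ' : G' →* MulAut N') where
  rel : Subgroup (N × N')
  op : Subgroup (G × G')
  functional : ∀ a, (1, a) ∈ rel → a = 1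
  surjective : ∀ a, ∃ n, (n, a) ∈ rel
  normal : (rel.map (MonoidHom.fst N N')).Normal
  op_surjective : ∀ g', ∃ g, (g, g') ∈ op
  equivariant : ∀ g g', (g, g') ∈ op → ∀ n a, (n, a) ∈ rel → (φ g n, φ' g' a) ∈ rel

namespace NormalSection

section

variable {G N G' N' : Type*} [Group G] [Group N] [Group G'] [Group N'] {φ : G →* MulAut N}
  {φ' : G' →* MulAut N'} (s : NormalSection φ φ')

theorem unique {n : N} {a b : N'} (ha : (n, a) ∈ s.rel) (hb : (n, b) ∈ s.rel) : a = b := by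
  have h := s.rel.mul_mem ha (s.rel.inv_mem hb)
  rw [← mul_inv_eq_one]
  exact s.functional _ (by simpa using h)

/-- The projection of the graph to `N`; its range is the normal subgroup of which `N'` is a
quotient. -/
def toLeft : s.rel →* N := (MonoidHom.fst N N').comp s.rel.subtype

/-- The projection of the graph to `N'`. -/
def toRight : s.rel →* N' := (MonoidHom.snd N N').comp s.rel.subtype

theorem toLeft_injective : Function.Injective s.toLeft := by
  rintro ⟨⟨n, a⟩, ha⟩ ⟨⟨m, b⟩, hb⟩ (h : n = m)
  subst h
  exact Subtype.ext (Prod.ext rfl (s.unique ha hb))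

theorem toRight_surjective : Function.Surjective s.toRight := fun a =>
  let ⟨n, hn⟩ := s.surjective a
  ⟨⟨(n, a), hn⟩, rfl⟩

theorem range_toLeft_normal : s.toLeft.range.Normal := by
  rw [toLeft, MonoidHom.range_comp, Subgroup.range_subtype]
  exact s.normal

/-- The subgroup of `N` that corresponds to the subgroup `A` of the section. -/
def pullback (A : Subgroup N') : Subgroup N := (A.comap s.toRight).map s.toLeft

theorem mem_pullback {A : Subgroup N'} {n : N} : n ∈ s.pullback A ↔ ∃ a ∈ A, (n, a) ∈ s.rel := by
  constructor
  · rintro ⟨⟨⟨n, a⟩, hr⟩, ha, rfl⟩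
    exact ⟨a, ha, hr⟩
  · rintro ⟨a, ha, hr⟩
    exact ⟨⟨(n, a), hr⟩, ha, rfl⟩

theorem mem_pullback_iff {A : Subgroup N'} {n : N} {a : N'} (h : (n, a) ∈ s.rel) :
    n ∈ s.pullback A ↔ a ∈ A := by
  rw [mem_pullback]
  exact ⟨fun ⟨b, hb, hr⟩ => s.unique hr h ▸ hb, fun ha => ⟨a, ha, h⟩⟩

theorem map_pullback_le {A : Subgroup N'} {g : G} {g' : G'} (hg : (g, g') ∈ s.op)
    (hA : A.map (φ' g').toMonoidHom = A) :
    (s.pullback A).map (φ g).toMonoidHom ≤ s.pullback A := by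
  rintro _ ⟨n, hn, rfl⟩
  obtain ⟨a, ha, hr⟩ := s.mem_pullback.1 hn
  refine s.mem_pullback.2 ⟨_, ?_, s.equivariant g g' hg n a hr⟩
  rw [← hA]
  exact ⟨a, ha, rfl⟩

theorem map_pullback_eq {A : Subgroup N'} {g : G} {g' : G'} (hg : (g, g') ∈ s.op)
    (hA : A.map (φ' g').toMonoidHom = A) :
    (s.pullback A).map (φ g).toMonoidHom = s.pullback A := by
  refine le_antisymm (s.map_pullback_le hg hA) fun n hn => ?_
  have hA' : A.map (φ' g'⁻¹).toMonoidHom = A := by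
    conv_lhs => rw [← hA]
    rw [Subgroup.map_map]
    convert A.map_id
    ext x
    simp
  have h := s.map_pullback_le (s.op.inv_mem hg) hA' ⟨n, hn, rfl⟩
  exact ⟨_, h, by simp⟩

/-- The range of `toLeft` is normal in `N`, so subnormal subgroups of the section pull back to
subnormal subgroups of `N`, and the quotients do not change. -/
theorem isCompositionFactor_pullback {N N' : Type u} [Group N] [Group N'] {φ : G →* MulAut N}
    {φ' : G' →* MulAut N'} (s : NormalSection φ φ') {A B : Subgroup N'}
    (h : IsCompositionFactor A B) : IsCompositionFactor (s.pullback A) (s.pullback B) := by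
  have hBn := h.normal
  let e : A.comap s.toRight ≃* s.pullback A :=
    (A.comap s.toRight).equivMapOfInjective s.toLeft s.toLeft_injective
  let f : s.pullback A →* A ⧸ B.subgroupOf A :=
    (QuotientGroup.mk' _).comp ((s.toRight.subgroupComap A).comp e.symm.toMonoidHom)
  have hf : Function.Surjective f :=
    (QuotientGroup.mk'_surjective _).comp
      ((MonoidHom.subgroupComap_surjective_of_surjective _ _ s.toRight_surjective).comp
        e.symm.surjective)
  have hker : f.ker = (s.pullback B).subgroupOf (s.pullback A) := by
    ext x
    obtain ⟨⟨⟨⟨n, a⟩, hr⟩, ha⟩, rfl⟩ := e.surjective x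
    have h1 : f (e ⟨⟨(n, a), hr⟩, ha⟩) = QuotientGroup.mk' (B.subgroupOf A) ⟨a, ha⟩ := by
      change QuotientGroup.mk' _ (s.toRight.subgroupComap A (e.symm (e _))) = _
      rw [e.symm_apply_apply]
      rfl
    rw [MonoidHom.mem_ker, h1, Subgroup.mem_subgroupOf]
    exact (QuotientGroup.eq_one_iff _).trans (s.mem_pullback_iff hr).symm
  have hn : ((s.pullback B).subgroupOf (s.pullback A)).Normal := hker ▸ inferInstance
  refine ⟨?_, Subgroup.map_mono (Subgroup.comap_mono h.le), hn, ?_⟩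
  · have h1 := ((h.subnormal.comap s.toRight).map s.toLeft.rangeRestrict_surjective).trans'
      s.range_toLeft_normal.isSubnormal
    rwa [Subgroup.map_map, MonoidHom.subtype_comp_rangeRestrict] at h1
  · have := h.simple
    exact ((QuotientGroup.quotientMulEquivOfEq hker.symm).trans
      (QuotientGroup.quotientKerEquivOfSurjective f hf)).isSimpleGroup

end

variable {G N G' N' : Type u} [Group G] [Group N] [Group G'] [Group N'] {φ : G →* MulAut N}
  {φ' : G' →* MulAut N'}

/-- The pairs of elements of the two semidirect products whose components correspond to each
other. -/
def semidirectRel (s : NormalSection φ φ') : Subgroup ((N ⋊[QuotientGroup.kerLift φ] (G ⧸ φ.ker)) ×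
    (N' ⋊[QuotientGroup.kerLift φ'] (G' ⧸ φ'.ker))) where
  carrier := {p | (p.1.left, p.2.left) ∈ s.rel ∧
    ∃ g g', (g, g') ∈ s.op ∧ p.1.right = QuotientGroup.mk g ∧ p.2.right = QuotientGroup.mk g'}
  one_mem' := ⟨s.rel.one_mem, 1, 1, s.op.one_mem, rfl, rfl⟩
  mul_mem' := by
    rintro ⟨p, p'⟩ ⟨q, q'⟩ ⟨hp, g, g', hg, hpg, hpg'⟩ ⟨hq, k, k', hk, hqk, hqk'⟩
    refine ⟨?_, g * k, g' * k', s.op.mul_mem hg hk, ?_, ?_⟩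
    · have h := s.rel.mul_mem hp (s.equivariant g g' hg _ _ hq)
      dsimp only at hpg hpg'
      simpa [SemidirectProduct.mul_left, hpg, hpg'] using h
    · dsimp only at hpg hqk
      simp [SemidirectProduct.mul_right, hpg, hqk]
    · dsimp only at hpg' hqk'
      simp [SemidirectProduct.mul_right, hpg', hqk']
  inv_mem' := by
    rintro ⟨p, p'⟩ ⟨hp, g, g', hg, hpg, hpg'⟩
    refine ⟨?_, g⁻¹, g'⁻¹, s.op.inv_mem hg, ?_, ?_⟩
    · have h := s.equivariant _ _ (s.op.inv_mem hg) _ _ (s.rel.inv_mem hp)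
      dsimp only at hpg hpg'
      simpa [SemidirectProduct.inv_left, hpg, hpg'] using h
    · dsimp only at hpg
      simp [SemidirectProduct.inv_right, hpg]
    · dsimp only at hpg'
      simp [SemidirectProduct.inv_right, hpg']

/-- Since operators of `N` that act trivially only correspond to operators of `N'` that act
trivially, `N' ⋊ G'/ker φ'` is a quotient of a subgroup of `N ⋊ G/ker φ`. -/
theorem semidirect_mem [Finite G] [Finite N] [Finite G'] [Finite N'] (s : NormalSection φ φ')
    {F : GroupClass.{u}} (hform : F.IsFormation) (hher : F.IsHereditary)
    (h : F (N ⋊[QuotientGroup.kerLift φ] (G ⧸ φ.ker))) :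
    F (N' ⋊[QuotientGroup.kerLift φ'] (G' ⧸ φ'.ker)) := by
  have h1 : Function.Injective ((MonoidHom.fst _ _).comp s.semidirectRel.subtype) := by
    rw [injective_iff_map_eq_one]
    rintro ⟨⟨p, p'⟩, hp, g, g', hg, hpg, hpg'⟩ (h1 : p = 1)
    subst h1
    have hleft : p'.left = 1 := s.functional _ hp
    have hgk : φ g = 1 := (QuotientGroup.eq_one_iff (N := φ.ker) g).1 hpg.symm
    have hright : φ' g' = 1 := by
      ext a
      obtain ⟨n, hn⟩ := s.surjective a
      have h2 := s.equivariant g g' hg n a hn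
      rw [hgk] at h2
      exact s.unique h2 hn
    refine Subtype.ext (Prod.ext rfl (SemidirectProduct.ext hleft ?_))
    exact hpg'.trans ((QuotientGroup.eq_one_iff (N := φ'.ker) g').2 hright)
  refine hform.of_surjective ((MonoidHom.snd _ _).comp s.semidirectRel.subtype) ?_
    (hform.of_injective hher _ h1 h)
  rintro ⟨a, g'⟩
  obtain ⟨g', rfl⟩ := QuotientGroup.mk_surjective g'
  obtain ⟨n, hn⟩ := s.surjective a
  obtain ⟨g, hg⟩ := s.op_surjective g'
  exact ⟨⟨(⟨n, QuotientGroup.mk g⟩, ⟨a, QuotientGroup.mk g'⟩), hn, g, g', hg, rfl, rfl⟩, rfl⟩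

/-- Admissibility passes to nontrivial normal sections. In the noncentral case the group is a power
of a nonabelian simple group, since `F` contains the nilpotent groups; hence the section is a power
of the same simple group with at most as many factors, and its composition factors are composition
factors of the whole group. -/
theorem isAdmissible [Finite G] [Finite N] [Finite G'] [Finite N'] [Nontrivial N']
    (s : NormalSection φ φ') {F : GroupClass.{u}} (hform : F.IsFormation) (hher : F.IsHereditary)
    (hnil : F.ContainsNilpotent) {R : GeneralizedRankFunction.{u}} (hR : R.IsVeryGood)
    (h : IsAdmissible F R φ) : IsAdmissible F R φ' := by
  obtain h | ⟨hN, n, ⟨S, _, hS, hpow⟩, hrank⟩ := h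
  · exact Or.inl (s.semidirect_mem hform hher h)
  have hna := GroupClass.exists_not_commute hnil hpow hN
  obtain ⟨k, hk, hpow'⟩ := hpow.of_normal_section hS hna s.toLeft s.toLeft_injective
    s.range_toLeft_normal s.toRight s.toRight_surjective
  have : Finite S := by
    obtain ⟨hn, ⟨e⟩⟩ := hpow
    exact Finite.of_surjective (fun x => e x ⟨0, hn⟩)
      ((Function.surjective_eval _).comp e.surjective)
  refine Or.inr ⟨fun hN' => hN (hform.of_isDirectPower hnil hpow' hpow hN'), k,
    ⟨S, _, hS, hpow'⟩, ?_⟩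
  rw [R.A_eq N S n hS hpow, R.B_eq N S n hS hpow] at hrank
  rw [R.A_eq N' S k hS hpow', R.B_eq N' S k hS hpow']
  refine hrank.imp (fun hA => (hR S hS).1 n hA k hpow'.1 hk) ?_
  rintro ⟨hB, hinner⟩
  refine ⟨(hR S hS).2 n hB k hpow'.1 hk, fun g' A B hAB hfix => ?_⟩
  obtain ⟨g, hg⟩ := s.op_surjective g'
  obtain ⟨m, hm, hmy⟩ := hinner g _ _ (s.isCompositionFactor_pullback hAB)
    ⟨s.map_pullback_eq hg hfix.1, s.map_pullback_eq hg hfix.2⟩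
  obtain ⟨a, ha, hma⟩ := s.mem_pullback.1 hm
  refine ⟨a, ha, fun y hy => ?_⟩
  obtain ⟨x, hx⟩ := s.surjective y
  have hconj := s.rel.mul_mem (s.rel.mul_mem hma hx) (s.rel.inv_mem hma)
  exact (s.mem_pullback_iff (s.rel.mul_mem (s.rel.inv_mem hconj) (s.equivariant g g' hg x y hx))).1
    (hmy x ((s.mem_pullback_iff hx).2 hy))

end NormalSection

/-! ### Normal sections relating chief factors -/

namespace ChiefFactor

variable {G H : Type u} [Group G] [Group H]

/-- The projection of `top` onto the chief factor. -/
def proj (C : ChiefFactor G) : C.top →* C.quot :=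
  (QuotientGroup.mk' C.bot).subgroupMap C.top

theorem proj_surjective (C : ChiefFactor G) : Function.Surjective C.proj :=
  (QuotientGroup.mk' C.bot).subgroupMap_surjective C.top

theorem proj_eq_one (C : ChiefFactor G) {t : C.top} : C.proj t = 1 ↔ (t : G) ∈ C.bot := by
  rw [← QuotientGroup.eq_one_iff, Subtype.ext_iff]
  rfl

theorem proj_eq_proj (C : ChiefFactor G) {t t' : C.top} :
    C.proj t = C.proj t' ↔ (t : G)⁻¹ * t' ∈ C.bot := by
  rw [← QuotientGroup.eq, Subtype.ext_iff]
  rfl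

theorem action_proj (C : ChiefFactor G) (g : G) (t : C.top) :
    C.action g (C.proj t) = C.proj (MulAut.conjNormal g t) := by
  apply Subtype.ext
  simp only [action, MonoidHom.comp_apply, MulAut.conjNormal_apply]
  change _ * (t : G ⧸ C.bot) * _ = ((MulAut.conjNormal g t : G) : G ⧸ C.bot)
  simp

instance nontrivial_quot (C : ChiefFactor G) : Nontrivial C.quot := by
  obtain ⟨x, hx, hx'⟩ := SetLike.exists_of_lt C.bot_lt_top
  exact ⟨⟨C.proj ⟨x, hx⟩, 1, fun h => hx' (C.proj_eq_one.1 h)⟩⟩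

/-- A relation `op` between groups `H` and `G` which is compatible with chief factors of `H` and `G`
makes the latter a normal section of the former. -/
def normalSection (D : ChiefFactor H) (C : ChiefFactor G) (op : Subgroup (H × G))
    (hker : ∀ h g, (h, g) ∈ op → h ∈ D.bot → g ∈ C.top → g ∈ C.bot)
    (hsurj : ∀ t ∈ C.top, ∃ h ∈ D.top, ∃ g ∈ C.top, (h, g) ∈ op ∧ t⁻¹ * g ∈ C.bot)
    (hleft : ∀ h ∈ D.top, ∃ g, (h, g) ∈ op) (hright : ∀ g, ∃ h, (h, g) ∈ op) :
    NormalSection D.action C.action where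
  rel := (op.comap (D.top.subtype.prodMap C.top.subtype)).map (D.proj.prodMap C.proj)
  op := op
  functional := by
    rintro a ⟨⟨h, g⟩, hop, heq⟩
    obtain ⟨h1, h2⟩ := Prod.ext_iff.1 heq
    rw [← show C.proj g = a from h2]
    exact C.proj_eq_one.2 (hker h g hop (D.proj_eq_one.1 h1) g.2)
  surjective a := by
    obtain ⟨t, rfl⟩ := C.proj_surjective a
    obtain ⟨h, hh, g, hg, hop, hb⟩ := hsurj t t.2
    exact ⟨D.proj ⟨h, hh⟩, (⟨h, hh⟩, ⟨g, hg⟩), hop, Prod.ext rfl (C.proj_eq_proj.2 hb).symm⟩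
  normal := by
    refine ⟨?_⟩
    rintro _ ⟨_, ⟨⟨h, g⟩, hop, rfl⟩, rfl⟩ x
    obtain ⟨k, rfl⟩ := D.proj_surjective x
    obtain ⟨m, hm⟩ := hleft k k.2
    refine ⟨_, ⟨(k * h * k⁻¹, ⟨m * g * m⁻¹, C.top_normal.conj_mem g g.2 m⟩), ?_, rfl⟩, ?_⟩
    · exact op.mul_mem (op.mul_mem hm hop) (op.inv_mem hm)
    · simp
  op_surjective := hright
  equivariant := by
    rintro k m hm _ _ ⟨⟨h, g⟩, hop, heq⟩
    obtain ⟨rfl, rfl⟩ := Prod.ext_iff.1 heq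
    refine ⟨(MulAut.conjNormal k h, MulAut.conjNormal m g), ?_, ?_⟩
    · exact op.mul_mem (op.mul_mem hm hop) (op.inv_mem hm)
    · simp [action_proj]

/-- A nontrivial normal subgroup of a finite group is the top of some chief factor. -/
theorem exists_top_eq [Finite G] (L : Subgroup G) (hL : L.Normal) (hbot : L ≠ ⊥) :
    ∃ C : ChiefFactor G, C.top = L := by
  obtain ⟨K, ⟨hK, hKL⟩, hmax⟩ := (Set.toFinite {K : Subgroup G | K.Normal ∧ K < L}).exists_maximal
    ⟨⊥, inferInstance, bot_lt_iff_ne_bot.2 hbot⟩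
  refine ⟨⟨L, K, hL, hK, hKL, fun M hM hKM hML => ?_⟩, rfl⟩
  rcases hML.eq_or_lt with h | h
  · exact Or.inr h
  · exact Or.inl (le_antisymm (hmax ⟨hM, h⟩ hKM) hKM)

/-- If a relation between `H` and `G`, total on both sides, relates `1` to no element of
`top \ bot`, then the chief factor `top/bot` of `G` is a normal section of a chief factor of `H`,
the one cut out by the elements related to `top` and to `bot`. -/
theorem exists_normalSection (C : ChiefFactor G) (op : Subgroup (H × G))
    (hleft : ∀ h, ∃ g, (h, g) ∈ op) (hright : ∀ g, ∃ h, (h, g) ∈ op)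
    (hone : ∀ g ∈ C.top, (1, g) ∈ op → g ∈ C.bot) :
    ∃ D : ChiefFactor H, Nonempty (NormalSection D.action C.action) := by
  let corr (L : Subgroup G) : Subgroup H := (op ⊓ L.comap (MonoidHom.snd H G)).map
    (MonoidHom.fst H G)
  have mem_corr (L : Subgroup G) (h : H) : h ∈ corr L ↔ ∃ g ∈ L, (h, g) ∈ op := by
    constructor
    · rintro ⟨⟨h, g⟩, ⟨hop, hg⟩, rfl⟩
      exact ⟨g, hg, hop⟩
    · rintro ⟨g, hg, hop⟩
      exact ⟨(h, g), ⟨hop, hg⟩, rfl⟩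
  have corr_normal (L : Subgroup G) (hL : L.Normal) : (corr L).Normal := by
    refine ⟨fun h hh k => ?_⟩
    obtain ⟨g, hg, hop⟩ := (mem_corr L h).1 hh
    obtain ⟨m, hm⟩ := hleft k
    exact (mem_corr L _).2 ⟨m * g * m⁻¹, hL.conj_mem g hg m,
      op.mul_mem (op.mul_mem hm hop) (op.inv_mem hm)⟩
  have hker : ∀ h g, (h, g) ∈ op → h ∈ corr C.bot → g ∈ C.top → g ∈ C.bot := by
    intro h g hop hh hg
    obtain ⟨b, hb, hop'⟩ := (mem_corr _ _).1 hh
    have h1 := hone (g * b⁻¹) (C.top.mul_mem hg (C.top.inv_mem (C.bot_lt_top.le hb)))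
      (by simpa using op.mul_mem hop (op.inv_mem hop'))
    simpa using C.bot.mul_mem h1 hb
  refine ⟨⟨corr C.top, corr C.bot, corr_normal _ C.top_normal, corr_normal _ C.bot_normal, ?_, ?_⟩,
    ⟨normalSection _ C op hker ?_ (fun h _ => hleft h) hright⟩⟩
  · refine SetLike.lt_iff_le_and_exists.2 ⟨fun h hh => ?_, ?_⟩
    · obtain ⟨g, hg, hop⟩ := (mem_corr _ _).1 hh
      exact (mem_corr _ _).2 ⟨g, C.bot_lt_top.le hg, hop⟩
    · obtain ⟨t, ht, ht'⟩ := SetLike.exists_of_lt C.bot_lt_top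
      obtain ⟨h, hop⟩ := hright t
      exact ⟨h, (mem_corr _ _).2 ⟨t, ht, hop⟩, fun hh => ht' (hker h t hop hh ht)⟩
  · intro L hL hbL hLt
    -- The elements of `C.top` related to `L` form a normal subgroup between `C.bot` and `C.top`.
    let L' : Subgroup G := (op ⊓ L.comap (MonoidHom.fst H G)).map (MonoidHom.snd H G) ⊓ C.top
    have mem_L' (g : G) : g ∈ L' ↔ (∃ h ∈ L, (h, g) ∈ op) ∧ g ∈ C.top := by
      refine and_congr_left fun _ => ⟨?_, ?_⟩
      · rintro ⟨⟨h, g⟩, ⟨hop, hh⟩, rfl⟩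
        exact ⟨h, hh, hop⟩
      · rintro ⟨h, hh, hop⟩
        exact ⟨(h, g), ⟨hop, hh⟩, rfl⟩
    have hL' : L'.Normal := by
      refine ⟨fun g hg m => ?_⟩
      obtain ⟨⟨h, hh, hop⟩, hg⟩ := (mem_L' g).1 hg
      obtain ⟨k, hk⟩ := hright m
      exact (mem_L' _).2 ⟨⟨k * h * k⁻¹, hL.conj_mem h hh k,
        op.mul_mem (op.mul_mem hk hop) (op.inv_mem hk)⟩, C.top_normal.conj_mem g hg m⟩
    have hbL' : C.bot ≤ L' := fun b hb => by
      obtain ⟨k, hop⟩ := hright b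
      exact (mem_L' b).2 ⟨⟨k, hbL ((mem_corr _ _).2 ⟨b, hb, hop⟩), hop⟩, C.bot_lt_top.le hb⟩
    rcases C.eq_or_eq L' hL' hbL' inf_le_right with h | h
    · refine Or.inl (le_antisymm (fun l hl => ?_) hbL)
      obtain ⟨t, ht, hop⟩ := (mem_corr _ _).1 (hLt hl)
      exact (mem_corr _ _).2 ⟨t, h ▸ (mem_L' t).2 ⟨⟨l, hl, hop⟩, ht⟩, hop⟩
    · refine Or.inr (le_antisymm hLt fun k hk => ?_)
      obtain ⟨t, ht, hop⟩ := (mem_corr _ _).1 hk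
      rw [← h] at ht
      obtain ⟨⟨l, hl, hop'⟩, -⟩ := (mem_L' t).1 ht
      have h1 : k * l⁻¹ ∈ L := hbL ((mem_corr _ _).2 ⟨1, C.bot.one_mem,
        by simpa using op.mul_mem hop (op.inv_mem hop')⟩)
      simpa using L.mul_mem h1 hl
  · intro t ht
    obtain ⟨h, hop⟩ := hright t
    exact ⟨h, (mem_corr _ _).2 ⟨t, ht, hop⟩, t, ht, hop, by simp [C.bot.one_mem]⟩

/-- The chief factor of the semidirect product of a chief factor `C` with `G/C_G(C)` given by the
normal subgroup `C`. -/
noncomputable def ofSemidirect (C : ChiefFactor G) : ChiefFactor C.semidirect where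
  top := SemidirectProduct.inl.range
  bot := ⊥
  top_normal := by
    rw [SemidirectProduct.range_inl_eq_ker_rightHom]
    exact MonoidHom.normal_ker _
  bot_normal := inferInstance
  bot_lt_top := by
    obtain ⟨x, hx⟩ := exists_ne (1 : C.quot)
    refine bot_lt_iff_ne_bot.2 fun h => hx (SemidirectProduct.inl_injective
      (φ := QuotientGroup.kerLift C.action) ?_)
    exact (Subgroup.mem_bot.1 (h ▸ ⟨x, rfl⟩)).trans (map_one _).symm
  eq_or_eq L hL _ hLt := by
    let f : C.top →* C.semidirect := SemidirectProduct.inl.comp C.proj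
    have hn : ((L.comap f).map C.top.subtype).Normal := by
      refine ⟨?_⟩
      rintro _ ⟨t, ht, rfl⟩ g
      refine ⟨MulAut.conjNormal g t, ?_, MulAut.conjNormal_apply g t⟩
      have h := hL.conj_mem _ ht (SemidirectProduct.inr (QuotientGroup.mk g))
      have h1 : f (MulAut.conjNormal g t) = SemidirectProduct.inr (QuotientGroup.mk g) * f t *
          (SemidirectProduct.inr (QuotientGroup.mk g))⁻¹ := by
        rw [← map_inv]
        change _ = _ * SemidirectProduct.inl (C.proj t) * _
        rw [← SemidirectProduct.inl_aut]
        simp [f, action_proj]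
      change f _ ∈ L
      rw [h1]
      exact h
    have hbot : C.bot ≤ (L.comap f).map C.top.subtype := fun b hb => by
      refine ⟨⟨b, C.bot_lt_top.le hb⟩, ?_, rfl⟩
      have h1 : C.proj ⟨b, C.bot_lt_top.le hb⟩ = 1 := C.proj_eq_one.2 hb
      change SemidirectProduct.inl (C.proj _) ∈ L
      rw [h1, map_one]
      exact L.one_mem
    rcases C.eq_or_eq _ hn hbot (Subgroup.map_subtype_le _) with h | h
    · left
      refine (Subgroup.eq_bot_iff_forall _).2 fun x hx => ?_
      obtain ⟨y, rfl⟩ := hLt hx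
      obtain ⟨t, rfl⟩ := C.proj_surjective y
      have ht : (t : G) ∈ C.bot := h.le ⟨t, hx, rfl⟩
      rw [C.proj_eq_one.2 ht, map_one]
    · right
      refine le_antisymm hLt ?_
      rintro _ ⟨y, rfl⟩
      obtain ⟨t, rfl⟩ := C.proj_surjective y
      obtain ⟨t', ht', heq⟩ := h.ge t.2
      rwa [Subtype.ext heq] at ht'

/-- The embedding of a chief factor `C` into its semidirect product with `G/C_G(C)`. -/
noncomputable def inlTop (C : ChiefFactor G) : C.quot →* C.ofSemidirect.top :=
  SemidirectProduct.inl.rangeRestrict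

theorem inlTop_surjective (C : ChiefFactor G) : Function.Surjective C.inlTop :=
  SemidirectProduct.inl.rangeRestrict_surjective

/-- A chief factor `C` is isomorphic, as a group with operators, to the chief factor `C` of its
semidirect product with `G/C_G(C)`. -/
noncomputable def normalSectionOfSemidirect (C : ChiefFactor G) :
    NormalSection C.ofSemidirect.action C.action where
  rel := ((C.ofSemidirect.proj.comp C.inlTop).prod (MonoidHom.id C.quot)).range
  op := ((SemidirectProduct.inr.comp (QuotientGroup.mk' C.action.ker)).prod (MonoidHom.id G)).range
  functional := by
    rintro _ ⟨x, hx⟩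
    obtain ⟨h1, rfl⟩ := Prod.ext_iff.1 hx
    have h2 : (SemidirectProduct.inl x : C.semidirect) = 1 :=
      Subgroup.mem_bot.1 (C.ofSemidirect.proj_eq_one.1 h1)
    exact SemidirectProduct.inl_injective (h2.trans (map_one _).symm)
  surjective a := ⟨_, a, rfl⟩
  normal := by
    have h : Function.Surjective (C.ofSemidirect.proj.comp C.inlTop) :=
      C.ofSemidirect.proj_surjective.comp C.inlTop_surjective
    rw [← MonoidHom.range_comp, MonoidHom.fst_comp_prod, MonoidHom.range_eq_top.2 h]
    infer_instance
  op_surjective g := ⟨_, g, rfl⟩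
  equivariant := by
    rintro _ _ ⟨g, hg⟩ _ _ ⟨x, hx⟩
    obtain ⟨rfl, rfl⟩ := Prod.ext_iff.1 hg
    obtain ⟨rfl, rfl⟩ := Prod.ext_iff.1 hx
    refine ⟨C.action g x, Prod.ext ?_ rfl⟩
    refine Eq.trans ?_ (C.ofSemidirect.action_proj _ _).symm
    refine congrArg C.ofSemidirect.proj (Subtype.ext ?_)
    refine Eq.trans ?_ (MulAut.conjNormal_apply _ _).symm
    change SemidirectProduct.inl (C.action g x) = SemidirectProduct.inr (QuotientGroup.mk g) *
      SemidirectProduct.inl x * (SemidirectProduct.inr (QuotientGroup.mk g))⁻¹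
    rw [← map_inv, ← SemidirectProduct.inl_aut, QuotientGroup.kerLift_mk]

end ChiefFactor

/-! ### The hypercenter and the maximal subgroups -/

section Hypercenter

variable {F : GroupClass.{u}} {R : GeneralizedRankFunction.{u}} {G : Type u} [Group G] [Finite G]

theorem ChiefFactor.IsCentral.isAdmissible (hform : F.IsFormation) (hher : F.IsHereditary)
    (hnil : F.ContainsNilpotent) (hR : R.IsVeryGood) {C : ChiefFactor G}
    (hC : C.IsCentral (F.withRank R)) : IsAdmissible F R C.action :=
  C.normalSectionOfSemidirect.isAdmissible hform hher hnil hR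
    ((F.withRank_iff R _).1 hC C.ofSemidirect)

/-- A chief factor of `U Z` that `Z` covers is a normal section of a chief factor of `G` below `Z`,
and any other one is a normal section of a chief factor of `U`. -/
theorem withRank_sup (hform : F.IsFormation) (hher : F.IsHereditary) (hnil : F.ContainsNilpotent)
    (hR : R.IsVeryGood) {U Z : Subgroup G} (hU : F.withRank R U) (hZ : Z.Normal)
    (hcentral : ∀ C : ChiefFactor G, C.top ≤ Z → C.IsCentral (F.withRank R)) :
    F.withRank R ↥(U ⊔ Z) := by
  rw [GroupClass.withRank_iff] at hU ⊢
  intro C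
  by_cases hcov : C.top ⊓ Z.subgroupOf (U ⊔ Z) ≤ C.bot
  · -- Relate the elements of `U` and of `U Z` that have the same image modulo `Z`.
    let op : Subgroup (U × ↥(U ⊔ Z)) :=
      ((QuotientGroup.mk' Z).comp (U.subtype.comp (MonoidHom.fst _ _))).eqLocus
        ((QuotientGroup.mk' Z).comp ((U ⊔ Z).subtype.comp (MonoidHom.snd _ _)))
    have mem_op (u : U) (m : ↥(U ⊔ Z)) : (u, m) ∈ op ↔ (u : G)⁻¹ * m ∈ Z := QuotientGroup.eq
    obtain ⟨D, ⟨s⟩⟩ := C.exists_normalSection op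
      (fun u => ⟨⟨u, Subgroup.mem_sup_left u.2⟩, (mem_op _ _).2 (by simp [Z.one_mem])⟩)
      (fun m => by
        obtain ⟨u, hu, z, hz, h⟩ := Subgroup.mem_sup_of_normal_right.1 m.2
        exact ⟨⟨u, hu⟩, (mem_op _ _).2 (by simpa [← h] using hz)⟩)
      (fun m hm h => hcov ⟨hm, by simpa [Subgroup.mem_subgroupOf] using (mem_op _ _).1 h⟩)
    exact s.isAdmissible hform hher hnil hR (hU D)
  · -- Take `D.top` minimal among the normal subgroups of `G` below `Z` that cover `C`.
    obtain ⟨L, ⟨hL, hLZ, hcov⟩, hmin⟩ := (Set.toFinite {L : Subgroup G | L.Normal ∧ L ≤ Z ∧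
      ¬ C.top ⊓ L.subgroupOf (U ⊔ Z) ≤ C.bot}).exists_minimal ⟨Z, hZ, le_rfl, hcov⟩
    obtain ⟨D, rfl⟩ := ChiefFactor.exists_top_eq L hL (by
      rintro rfl
      exact hcov (by simp))
    have hbot : C.top ⊓ D.bot.subgroupOf (U ⊔ Z) ≤ C.bot := by
      by_contra h
      exact D.bot_lt_top.not_ge
        (hmin ⟨D.bot_normal, D.bot_lt_top.le.trans hLZ, h⟩ D.bot_lt_top.le)
    have htop : C.bot ⊔ C.top ⊓ D.top.subgroupOf (U ⊔ Z) = C.top :=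
      (C.eq_or_eq _ inferInstance le_sup_left (sup_le C.bot_lt_top.le inf_le_left)).resolve_left
        fun h => hcov (h ▸ le_sup_right)
    -- Relate every element of `U Z` to itself as an element of `G`.
    let op : Subgroup (G × ↥(U ⊔ Z)) := ((U ⊔ Z).subtype.prod (MonoidHom.id _)).range
    have mem_op (m : ↥(U ⊔ Z)) : ((m : G), m) ∈ op := ⟨m, rfl⟩
    refine (D.normalSection C op ?_ ?_ (fun h hh => ?_) fun m => ⟨m, mem_op m⟩).isAdmissible
      hform hher hnil hR ((hcentral D hLZ).isAdmissible hform hher hnil hR)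
    · rintro _ _ ⟨m, hm⟩ hb ht
      obtain ⟨rfl, rfl⟩ := Prod.ext_iff.1 hm
      exact hbot ⟨ht, hb⟩
    · intro t ht
      rw [← htop] at ht
      obtain ⟨b, hb, m, hm, rfl⟩ := Subgroup.mem_sup_of_normal_right.1 ht
      refine ⟨m, hm.2, m, hm.1, mem_op m, ?_⟩
      have := C.bot_normal.conj_mem' _ (C.bot.inv_mem hb) m
      simpa [mul_assoc] using this
    · exact ⟨⟨h, Subgroup.mem_sup_right (hLZ hh)⟩, mem_op ⟨h, Subgroup.mem_sup_right (hLZ hh)⟩⟩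

end Hypercenter

theorem mainTheorem6 (F : GroupClass.{u}) (hform : F.IsFormation) (hher : F.IsHereditary)
    (hsat : F.IsSaturated) (hnil : F.ContainsNilpotent)
    (R : GeneralizedRankFunction.{u}) (hR : R.IsVeryGood)
    (G : Type u) [Group G] [Finite G] :
    hypercenter (F.withRank R) G ≤ intMaximal (F.withRank R) G := by
  refine sSup_le fun Z ⟨hZ, hcentral⟩ => le_sInf fun U hU => ?_
  have h := withRank_sup hform hher hnil hR hU.1 hZ hcentral
  rw [hU.2 _ le_sup_left h]
  exact le_sup_right
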